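/- Let $n\in\mathbb N$, $\alpha>0$, and let $K$ be a nonsingular real $n\times n$ matrix. An $\mathbb R^n$-valued random variable $X=(X_1,\dots,X_n)$ is called an $\alpha$-permanental vector with kernel $K$ if $$E\Big(e^{-\sum_{i=1}^n s_iX_i}\Big)=\frac{1}{|I+KS|^{\alpha}}\qquad\text{for all } s_1,\dots,s_n\ge 0,$$ where $S=\operatorname{diag}(s_1,\dots,s_n)$ and $|\cdot|$ is the determinant. A real square matrix $A$ is called a nonsingular $M$-matrix if its off-diagonal entries are all $\le 0$, $A$ is nonsingular, and all entries of $A^{-1}$ are $\ge 0$. Let $X$ be an $\alpha$-permanental vector with nonsingular kernel $K$, and assume that $A=K^{-1}$ is a nonsingular $M$-matrix with diagonal entries $a_1,\dots,a_n$. Then there is a coupling of $X$ with an $n$-tuple $(\xi^{(1)},\dots,\xi^{(n)})$ of independent, identically distributed random variables, each with the Gamma density $x^{\alpha-1}e^{-x}/\Gamma(\alpha)$ on $(0,\infty)$, that is, a probability space carrying a random vector $X'=(X'_1,\dots,X'_n)$ with the same law as $X$ together with such a tuple, such that almost surely $$X'_i\ \ge\ a_i^{-1}\,\xi^{(i)}\qquad\text{for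 all } i=1,\dots,n.$$ -/

import Mathlib

open MeasureTheory ProbabilityTheory

/-- A real square matrix `A` is a nonsingular M-matrix: its off-diagonal entries are nonpositive,
it is invertible, and all entries of its inverse are nonnegative. -/
structure IsNonsingularMMatrix {n : ℕ} (A : Matrix (Fin n) (Fin n) ℝ) : Prop where
  offDiag_nonpos : ∀ i j, i ≠ j → A i j ≤ 0
  nonsingular : IsUnit A
  inv_nonneg : ∀ i j, 0 ≤ A⁻¹ i j

/-- The `ℝⁿ`-valued random variable `X` on `(Ω, P)` is an `α`-permanental vector with kernel `K`:
for all `s₁, …, sₙ ≥ 0`, with `S = diag(s₁, …, sₙ)`, one has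
`E (exp (-∑ i, sᵢ Xᵢ)) = 1 / |I + K S| ^ α`, the expectation being finite.
(If `P` is a probability measure and `α ≠ 0`, the left side is positive, so `|I + K S|` never
vanishes; being `1` at `s = 0`, it is positive throughout, and the real power is the usual one.) -/
structure IsPermanentalVector {Ω : Type*} [MeasurableSpace Ω] (P : Measure Ω) {n : ℕ} (α : ℝ)
    (K : Matrix (Fin n) (Fin n) ℝ) (X : Ω → Fin n → ℝ) : Prop where
  aemeasurable : AEMeasurable X P
  integrable : ∀ s : Fin n → ℝ, (∀ i, 0 ≤ s i) →
    Integrable (fun ω => Real.exp (-∑ i, s i * X ω i)) P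
  laplace : ∀ s : Fin n → ℝ, (∀ i, 0 ≤ s i) →
    ∫ ω, Real.exp (-∑ i, s i * X ω i) ∂P = 1 / (1 + K * Matrix.diagonal s).det ^ α

/-! Let D be the diagonal part of A and M = 1 - D⁻¹A. The M-matrix property makes M entrywise
nonnegative with convergent Neumann series. With xᵢ = (1 + sᵢ/aᵢ)⁻¹, factoring A + S gives |I +
KS|^(-α) = ∏ xᵢ^α · |1 - M|^α |1 - diag(x) M|^(-α). The product ∏ xᵢ^α is the transform of (ξ⁽ⁱ⁾/aᵢ)
for independent Gamma(α) variables. The remaining factor is a power series in x with nonnegative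
coefficients (`isNonnegPowerSeries_det_one_sub_rpow_neg`), equal to 1 at x = (1, …, 1). Since xᵢ^m
is the transform of an Erlang(m) variable divided by aᵢ, that factor is the transform of (ηᵢ/aᵢ),
where η ≥ 0 is a mixture of vectors of independent Erlang variables. Taking η independent of ξ,
uniqueness of Laplace transforms gives X the law of ((ξ⁽ⁱ⁾ + ηᵢ)/aᵢ), which dominates ξ⁽ⁱ⁾/aᵢ.
Series take values in [0, ∞] over arbitrary index types with repeated monomials allowed, so sums and
products need neither convergence arguments nor collection of terms. -/

/-! ### Power series with nonnegative coefficients. -/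

/-- On the cube `[0, 1]ⁿ`, `g` is the sum of a power series with coefficients in `[0, ∞]`. -/
def IsNonnegPowerSeries {n : ℕ} (g : (Fin n → ℝ) → ENNReal) : Prop :=
  ∃ (ι : Type) (c : ι → ENNReal) (e : ι → Fin n → ℕ), ∀ x : Fin n → ℝ,
    (∀ i, x i ∈ Set.Icc (0 : ℝ) 1) → g x = ∑' i, c i * ∏ j, ENNReal.ofReal (x j) ^ e i j

namespace IsNonnegPowerSeries

variable {n : ℕ} {g h : (Fin n → ℝ) → ENNReal}

theorem congr (hg : IsNonnegPowerSeries g)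
    (hgh : ∀ x : Fin n → ℝ, (∀ i, x i ∈ Set.Icc (0 : ℝ) 1) → h x = g x) :
    IsNonnegPowerSeries h := by
  obtain ⟨ι, c, e, H⟩ := hg
  exact ⟨ι, c, e, fun x hx => (hgh x hx).trans (H x hx)⟩

theorem const (a : ENNReal) : IsNonnegPowerSeries (fun _ : Fin n → ℝ => a) :=
  ⟨Unit, fun _ => a, fun _ _ => 0, fun x _ => by simp⟩

theorem coord (j : Fin n) :
    IsNonnegPowerSeries (fun x : Fin n → ℝ => ENNReal.ofReal (x j)) :=
  ⟨Unit, fun _ => 1, fun _ => Pi.single j 1, fun x _ => by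
    simp [Pi.single_apply, pow_ite, Finset.prod_ite_eq']⟩

theorem mul (hg : IsNonnegPowerSeries g) (hh : IsNonnegPowerSeries h) :
    IsNonnegPowerSeries (fun x => g x * h x) := by
  obtain ⟨ι, c, e, H⟩ := hg
  obtain ⟨κ, d, f, H'⟩ := hh
  refine ⟨ι × κ, fun p => c p.1 * d p.2, fun p => e p.1 + f p.2, fun x hx => ?_⟩
  dsimp only
  rw [ENNReal.tsum_prod', H x hx, H' x hx, ← ENNReal.tsum_mul_right]
  refine tsum_congr fun i => ?_
  rw [← ENNReal.tsum_mul_left]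
  refine tsum_congr fun k => ?_
  simp only [Pi.add_apply, pow_add, Finset.prod_mul_distrib]
  ring

theorem tsum {κ : Type} {G : κ → (Fin n → ℝ) → ENNReal} (hG : ∀ k, IsNonnegPowerSeries (G k)) :
    IsNonnegPowerSeries (fun x => ∑' k, G k x) := by
  choose ι c e H using hG
  refine ⟨Σ k, ι k, fun p => c p.1 p.2, fun p => e p.1 p.2, fun x hx => ?_⟩
  rw [ENNReal.tsum_sigma (f := fun k i => c k i * ∏ j, ENNReal.ofReal (x j) ^ e k i j)]
  exact tsum_congr fun k => H k x hx

theorem sum {κ : Type} [Fintype κ] {G : κ → (Fin n → ℝ) → ENNReal}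
    (hG : ∀ k, IsNonnegPowerSeries (G k)) : IsNonnegPowerSeries (fun x => ∑ k, G k x) :=
  (tsum hG).congr fun x _ => by rw [tsum_fintype]

theorem pow (hg : IsNonnegPowerSeries g) (m : ℕ) : IsNonnegPowerSeries (fun x => g x ^ m) := by
  induction m with
  | zero => simpa using const 1
  | succ m ih => simpa only [pow_succ] using ih.mul hg

end IsNonnegPowerSeries

/-- The binomial series of `(1 - y) ^ (-α)` has nonnegative coefficients. -/
theorem exists_ofReal_one_sub_rpow_neg_eq_tsum {α : ℝ} (hα : 0 < α) :
    ∃ b : ℕ → ENNReal, ∀ y : ℝ, 0 ≤ y → y < 1 →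
      ENNReal.ofReal ((1 - y) ^ (-α)) = ∑' m, b m * ENNReal.ofReal y ^ m := by
  -- The coefficient is the rising factorial α(α+1)⋯(α+m-1) divided by m!.
  have hb : ∀ m : ℕ, 0 ≤ Ring.choose (α + m - 1) m := fun m => by
    have h := Ring.factorial_nsmul_multichoose_eq_ascPochhammer α m
    rw [Polynomial.ascPochhammer_smeval_eq_eval, Ring.multichoose_eq, nsmul_eq_mul] at h
    have h1 := ascPochhammer_pos m α hα
    rw [← h] at h1
    exact (pos_of_mul_pos_right h1 (by positivity)).le
  refine ⟨fun m => ENNReal.ofReal (Ring.choose (α + m - 1) m), fun y h0 h1 => ?_⟩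
  have H := (Real.one_div_one_sub_rpow_hasFPowerSeriesOnBall_zero α).hasSum
    (y := y) (by simpa [enorm_eq_nnnorm, abs_of_nonneg h0, ← NNReal.coe_lt_coe] using h1)
  simp only [FormalMultilinearSeries.ofScalars_apply_eq, zero_add, smul_eq_mul] at H
  rw [Real.rpow_neg (by linarith), ← one_div, ← H.tsum_eq,
    ENNReal.ofReal_tsum_of_nonneg (fun m => mul_nonneg (hb m) (by positivity)) H.summable]
  refine tsum_congr fun m => ?_
  rw [ENNReal.ofReal_mul (hb m), ENNReal.ofReal_pow h0]

theorem IsNonnegPowerSeries.one_sub_rpow_neg {n : ℕ} {f : (Fin n → ℝ) → ℝ}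
    (hf : IsNonnegPowerSeries fun x => ENNReal.ofReal (f x))
    (h0 : ∀ x, (∀ i, x i ∈ Set.Icc (0 : ℝ) 1) → 0 ≤ f x)
    (h1 : ∀ x, (∀ i, x i ∈ Set.Icc (0 : ℝ) 1) → f x < 1) {α : ℝ} (hα : 0 < α) :
    IsNonnegPowerSeries fun x => ENNReal.ofReal ((1 - f x) ^ (-α)) := by
  obtain ⟨b, hb⟩ := exists_ofReal_one_sub_rpow_neg_eq_tsum hα
  exact (IsNonnegPowerSeries.tsum fun m => (IsNonnegPowerSeries.const (b m)).mul (hf.pow m)).congr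
    fun x hx => hb _ (h0 x hx) (h1 x hx)

/-! ### Neumann series of nonnegative matrices. -/

namespace Matrix

variable {n : ℕ}

theorem pow_le_pow_of_entrywise {N M : Matrix (Fin n) (Fin n) ℝ} (h0 : ∀ i j, 0 ≤ N i j)
    (h : ∀ i j, N i j ≤ M i j) (m : ℕ) (i j : Fin n) :
    0 ≤ (N ^ m) i j ∧ (N ^ m) i j ≤ (M ^ m) i j := by
  induction m generalizing i j with
  | zero => by_cases hij : i = j <;> simp [hij]
  | succ m ih =>
    simp only [pow_succ, Matrix.mul_apply]
    exact ⟨Finset.sum_nonneg fun k _ => mul_nonneg (ih i k).1 (h0 k j),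
      Finset.sum_le_sum fun k _ =>
        mul_le_mul (ih i k).2 (h k j) (h0 k j) ((ih i k).1.trans (ih i k).2)⟩

theorem summable_pow_of_entrywise_le {N M : Matrix (Fin n) (Fin n) ℝ} (h0 : ∀ i j, 0 ≤ N i j)
    (h : ∀ i j, N i j ≤ M i j) (hM : Summable fun m : ℕ => M ^ m) :
    Summable fun m : ℕ => N ^ m := by
  refine Pi.summable.2 fun i => Pi.summable.2 fun j => ?_
  exact Summable.of_nonneg_of_le (fun m => (pow_le_pow_of_entrywise h0 h m i j).1)
    (fun m => (pow_le_pow_of_entrywise h0 h m i j).2) (Pi.summable.1 (Pi.summable.1 hM i) j)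

theorem det_one_sub_ne_zero_of_summable {N : Matrix (Fin n) (Fin n) ℝ}
    (hN : Summable fun m : ℕ => N ^ m) : (1 - N).det ≠ 0 := by
  have h := congrArg Matrix.det hN.one_sub_mul_tsum_pow
  rw [Matrix.det_mul, Matrix.det_one] at h
  exact left_ne_zero_of_mul (h ▸ one_ne_zero)

theorem hasSum_pow_apply_inv_one_sub {N : Matrix (Fin n) (Fin n) ℝ}
    (hN : Summable fun m : ℕ => N ^ m) (i j : Fin n) :
    HasSum (fun m : ℕ => (N ^ m) i j) ((1 - N)⁻¹ i j) := by
  rw [Matrix.inv_eq_right_inv hN.one_sub_mul_tsum_pow]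
  exact Pi.hasSum.1 (Pi.hasSum.1 hN.hasSum i) j

/-- Along t ∈ [0, 1] the powers of tN stay dominated by those of N, so |1 - tN| never vanishes; it
is 1 at t = 0 and hence cannot change sign. -/
theorem det_one_sub_pos_of_summable {N : Matrix (Fin n) (Fin n) ℝ} (h0 : ∀ i j, 0 ≤ N i j)
    (hN : Summable fun m : ℕ => N ^ m) : 0 < (1 - N).det := by
  have hc : Continuous fun t : ℝ => (1 - t • N).det := by fun_prop
  by_contra hneg
  have h1 : (1 - (1 : ℝ) • N).det ≤ 0 := by simpa using not_lt.1 hneg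
  obtain ⟨t, ht, h⟩ := intermediate_value_Icc' zero_le_one hc.continuousOn
    (show (0 : ℝ) ∈ Set.Icc _ _ from ⟨h1, by simp⟩)
  refine det_one_sub_ne_zero_of_summable (summable_pow_of_entrywise_le (N := t • N)
    (fun i j => ?_) (fun i j => ?_) hN) h
  · exact mul_nonneg ht.1 (h0 i j)
  · exact mul_le_of_le_one_left (h0 i j) ht.2

end Matrix

/-! ### Expansion of a negative power of the determinant. -/

section DetPowerSeries

variable {n : ℕ} {M : Matrix (Fin n) (Fin n) ℝ}

/-- The vector `x` with the coordinates outside `S` set to zero. -/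
def restrictCoords (S : Finset (Fin n)) (x : Fin n → ℝ) (i : Fin n) : ℝ := if i ∈ S then x i else 0

theorem restrictCoords_mem (S : Finset (Fin n)) {x : Fin n → ℝ}
    (hx : ∀ i, x i ∈ Set.Icc (0 : ℝ) 1) (i : Fin n) :
    restrictCoords S x i ∈ Set.Icc (0 : ℝ) 1 := by
  unfold restrictCoords
  split_ifs
  exacts [hx i, ⟨le_rfl, zero_le_one⟩]

theorem diagonal_mul_nonneg (hM : ∀ i j, 0 ≤ M i j) {x : Fin n → ℝ}
    (hx : ∀ i, x i ∈ Set.Icc (0 : ℝ) 1) (i j : Fin n) :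
    0 ≤ (Matrix.diagonal x * M) i j := by
  rw [Matrix.diagonal_mul]
  exact mul_nonneg (hx i).1 (hM i j)

theorem summable_diagonal_mul_pow (hM : ∀ i j, 0 ≤ M i j) (hs : Summable fun m : ℕ => M ^ m)
    {x : Fin n → ℝ} (hx : ∀ i, x i ∈ Set.Icc (0 : ℝ) 1) :
    Summable fun m : ℕ => (Matrix.diagonal x * M) ^ m := by
  refine Matrix.summable_pow_of_entrywise_le (diagonal_mul_nonneg hM hx) (fun i j => ?_) hs
  rw [Matrix.diagonal_mul]
  exact mul_le_of_le_one_left (hM i j) (hx i).2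

theorem isNonnegPowerSeries_restrictCoords (S : Finset (Fin n)) (j : Fin n) :
    IsNonnegPowerSeries fun x => ENNReal.ofReal (restrictCoords S x j) := by
  by_cases hj : j ∈ S
  · simpa [restrictCoords, hj] using IsNonnegPowerSeries.coord j
  · simpa [restrictCoords, hj] using IsNonnegPowerSeries.const 0

theorem isNonnegPowerSeries_pow_apply (hM : ∀ i j, 0 ≤ M i j) (S : Finset (Fin n)) (m : ℕ)
    (i j : Fin n) : IsNonnegPowerSeries fun x =>
      ENNReal.ofReal (((Matrix.diagonal (restrictCoords S x) * M) ^ m) i j) := by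
  induction m generalizing i j with
  | zero => simpa using IsNonnegPowerSeries.const _
  | succ m ih =>
    refine (IsNonnegPowerSeries.sum fun k : Fin n => (ih i k).mul
      ((isNonnegPowerSeries_restrictCoords S k).mul
        (IsNonnegPowerSeries.const (ENNReal.ofReal (M k j))))).congr fun x hx => ?_
    have hx' := restrictCoords_mem S hx
    have h0 := diagonal_mul_nonneg hM hx'
    have hp : ∀ k, 0 ≤ ((Matrix.diagonal (restrictCoords S x) * M) ^ m) i k := fun k =>
      (Matrix.pow_le_pow_of_entrywise h0 (fun _ _ => le_rfl) m i k).1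
    rw [pow_succ, Matrix.mul_apply,
      ENNReal.ofReal_sum_of_nonneg fun k _ => mul_nonneg (hp k) (h0 k j)]
    refine Finset.sum_congr rfl fun k _ => ?_
    rw [ENNReal.ofReal_mul (hp k), Matrix.diagonal_mul, ENNReal.ofReal_mul (hx' k).1]

theorem isNonnegPowerSeries_inv_one_sub_apply (hM : ∀ i j, 0 ≤ M i j)
    (hs : Summable fun m : ℕ => M ^ m) (S : Finset (Fin n)) (i j : Fin n) :
    IsNonnegPowerSeries fun x =>
      ENNReal.ofReal ((1 - Matrix.diagonal (restrictCoords S x) * M)⁻¹ i j) := by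
  refine (IsNonnegPowerSeries.tsum fun m => isNonnegPowerSeries_pow_apply hM S m i j).congr
    fun x hx => ?_
  have hx' := restrictCoords_mem S hx
  have h := Matrix.hasSum_pow_apply_inv_one_sub (summable_diagonal_mul_pow hM hs hx') i j
  rw [← h.tsum_eq, ENNReal.ofReal_tsum_of_nonneg (fun m => ?_) h.summable]
  exact (Matrix.pow_le_pow_of_entrywise (diagonal_mul_nonneg hM hx') (fun _ _ => le_rfl) m i j).1

theorem inv_one_sub_diagonal_mul_nonneg (hM : ∀ i j, 0 ≤ M i j)
    (hs : Summable fun m : ℕ => M ^ m) {x : Fin n → ℝ} (hx : ∀ i, x i ∈ Set.Icc (0 : ℝ) 1)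
    (i j : Fin n) : 0 ≤ (1 - Matrix.diagonal x * M)⁻¹ i j :=
  (Matrix.hasSum_pow_apply_inv_one_sub (summable_diagonal_mul_pow hM hs hx) i j).nonneg fun m =>
    (Matrix.pow_le_pow_of_entrywise (diagonal_mul_nonneg hM hx) (fun _ _ => le_rfl) m i j).1

/-- Switching on coordinate j changes only row j, a rank-one update, so the matrix determinant lemma
applies. -/
theorem det_one_sub_diagonal_restrictCoords_insert {S : Finset (Fin n)} {j : Fin n} (hj : j ∉ S)
    {x : Fin n → ℝ} (hdet : (1 - Matrix.diagonal (restrictCoords S x) * M).det ≠ 0) :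
    (1 - Matrix.diagonal (restrictCoords (insert j S) x) * M).det =
      (1 - Matrix.diagonal (restrictCoords S x) * M).det *
        (1 - x j * ∑ k, M j k * (1 - Matrix.diagonal (restrictCoords S x) * M)⁻¹ k j) := by
  have hu : 1 - Matrix.diagonal (restrictCoords (insert j S) x) * M =
      (1 - Matrix.diagonal (restrictCoords S x) * M) +
        Matrix.replicateCol Unit (Pi.single j (-x j)) * Matrix.replicateRow Unit (M j) := by
    ext a b
    rw [Matrix.sub_apply, Matrix.add_apply, Matrix.sub_apply, Matrix.diagonal_mul,
      Matrix.diagonal_mul, Matrix.mul_apply]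
    simp only [Matrix.replicateCol_apply, Matrix.replicateRow_apply, restrictCoords,
      Finset.mem_insert, Finset.univ_unique, Finset.sum_singleton]
    by_cases ha : a = j
    · subst ha
      simp [hj]
      ring
    · simp [ha]
  rw [hu, Matrix.det_add_replicateCol_mul_replicateRow hdet.isUnit]
  congr 1
  rw [Matrix.det_unique, Matrix.add_apply, Matrix.one_apply_eq, Matrix.mul_apply]
  simp only [Matrix.replicateCol_apply, Matrix.mul_apply, Matrix.replicateRow_apply]
  simp [Pi.single_apply]
  ring

/-- Coordinates are switched on one at a time. Each contributes a factor (1 - f)^(-α), where f is a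
nonnegative series by the Neumann expansion of the inverse, and the binomial series finishes the
step. -/
theorem isNonnegPowerSeries_det_restrictCoords (hM : ∀ i j, 0 ≤ M i j)
    (hs : Summable fun m : ℕ => M ^ m) {α : ℝ} (hα : 0 < α) (S : Finset (Fin n)) :
    IsNonnegPowerSeries fun x =>
      ENNReal.ofReal ((1 - Matrix.diagonal (restrictCoords S x) * M).det ^ (-α)) := by
  have hpos : ∀ (S : Finset (Fin n)) (x : Fin n → ℝ), (∀ i, x i ∈ Set.Icc (0 : ℝ) 1) →
      0 < (1 - Matrix.diagonal (restrictCoords S x) * M).det := fun S x hx =>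
    Matrix.det_one_sub_pos_of_summable (diagonal_mul_nonneg hM (restrictCoords_mem S hx))
      (summable_diagonal_mul_pow hM hs (restrictCoords_mem S hx))
  induction S using Finset.induction_on with
  | empty =>
    have h : ∀ x : Fin n → ℝ, Matrix.diagonal (restrictCoords ∅ x) = 0 := fun x => by
      ext i j
      simp [restrictCoords, Matrix.diagonal_apply]
    simpa [h] using IsNonnegPowerSeries.const 1
  | insert j S hj ih =>
    have hins := fun (x : Fin n → ℝ) (hx : ∀ i, x i ∈ Set.Icc (0 : ℝ) 1) =>
      det_one_sub_diagonal_restrictCoords_insert hj (hpos S x hx).ne'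
    set f : (Fin n → ℝ) → ℝ := fun x =>
      x j * ∑ k, M j k * (1 - Matrix.diagonal (restrictCoords S x) * M)⁻¹ k j with hf
    have hterm : ∀ (x : Fin n → ℝ), (∀ i, x i ∈ Set.Icc (0 : ℝ) 1) → ∀ k,
        0 ≤ M j k * (1 - Matrix.diagonal (restrictCoords S x) * M)⁻¹ k j := fun x hx k =>
      mul_nonneg (hM j k) (inv_one_sub_diagonal_mul_nonneg hM hs (restrictCoords_mem S hx) k j)
    -- f < 1 because 1 - f is the ratio of two positive determinants.
    have hf1 : ∀ x : Fin n → ℝ, (∀ i, x i ∈ Set.Icc (0 : ℝ) 1) → 0 < 1 - f x := fun x hx => by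
      have h := hpos (insert j S) x hx
      rw [hins x hx] at h
      exact pos_of_mul_pos_right h (hpos S x hx).le
    have hfs : IsNonnegPowerSeries fun x => ENNReal.ofReal (f x) := by
      refine ((IsNonnegPowerSeries.coord j).mul (IsNonnegPowerSeries.sum fun k : Fin n =>
        (IsNonnegPowerSeries.const (ENNReal.ofReal (M j k))).mul
          (isNonnegPowerSeries_inv_one_sub_apply hM hs S k j))).congr fun x hx => ?_
      rw [hf, ENNReal.ofReal_mul (hx j).1, ENNReal.ofReal_sum_of_nonneg fun k _ => hterm x hx k]
      congr 1
      exact Finset.sum_congr rfl fun k _ => ENNReal.ofReal_mul (hM j k)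
    refine (ih.mul (hfs.one_sub_rpow_neg (fun x hx => ?_) (fun x hx => ?_) hα)).congr
      fun x hx => ?_
    · exact mul_nonneg (hx j).1 (Finset.sum_nonneg fun k _ => hterm x hx k)
    · linarith [hf1 x hx]
    · rw [hins x hx, Real.mul_rpow (hpos S x hx).le (hf1 x hx).le, ENNReal.ofReal_mul]
      exact Real.rpow_nonneg (hpos S x hx).le _

/-- For an entrywise nonnegative `M` with convergent Neumann series, `|1 - diag(x) M| ^ (-α)` is a
power series in `x` with nonnegative coefficients. -/
theorem isNonnegPowerSeries_det_one_sub_rpow_neg (hM : ∀ i j, 0 ≤ M i j)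
    (hs : Summable fun m : ℕ => M ^ m) {α : ℝ} (hα : 0 < α) :
    IsNonnegPowerSeries fun x => ENNReal.ofReal ((1 - Matrix.diagonal x * M).det ^ (-α)) := by
  have h : ∀ x : Fin n → ℝ, restrictCoords Finset.univ x = x := fun x => by
    funext i
    simp [restrictCoords]
  simpa only [h] using isNonnegPowerSeries_det_restrictCoords hM hs hα Finset.univ

end DetPowerSeries

/-! ### Laplace transforms of Gamma and Erlang laws and their mixtures. -/

/-- Exponential tilting turns the rate 1 density into (1 + t)^(-a) times the rate 1 + t density. -/
theorem lintegral_exp_neg_mul_gammaMeasure {a t : ℝ} (ha : 0 < a) (ht : 0 ≤ t) :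
    ∫⁻ x, ENNReal.ofReal (Real.exp (-(t * x))) ∂gammaMeasure a 1 =
      ENNReal.ofReal ((1 + t)⁻¹ ^ a) := by
  have ht' : 0 < 1 + t := by linarith
  rw [gammaMeasure, lintegral_withDensity_eq_lintegral_mul _
    (by unfold gammaPDF; fun_prop) (by fun_prop)]
  have h : ∀ x, (gammaPDF a 1 * fun x => ENNReal.ofReal (Real.exp (-(t * x)))) x =
      ENNReal.ofReal ((1 + t)⁻¹ ^ a) * gammaPDF a (1 + t) x := fun x => by
    simp only [Pi.mul_apply, gammaPDF_eq]
    rw [← ENNReal.ofReal_mul' (Real.exp_pos _).le, ← ENNReal.ofReal_mul (by positivity)]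
    congr 1
    split_ifs
    · rw [Real.inv_rpow ht'.le, show -((1 + t) * x) = -(1 * x) + -(t * x) by ring, Real.exp_add,
        Real.one_rpow]
      have := (Real.rpow_pos_of_pos ht' a).ne'
      field_simp
    · simp
  rw [lintegral_congr h, lintegral_const_mul _ (by unfold gammaPDF; fun_prop),
    lintegral_gammaPDF_eq_one ha ht', mul_one]

theorem ae_nonneg_gammaMeasure (a r : ℝ) : ∀ᵐ x ∂gammaMeasure a r, 0 ≤ x := by
  rw [gammaMeasure, ae_withDensity_iff (by unfold gammaPDF; fun_prop)]
  refine Filter.Eventually.of_forall fun x hx => ?_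
  by_contra h
  exact hx (gammaPDF_of_neg (not_le.1 h))

/-- The law of a sum of `m` independent standard exponential variables. -/
noncomputable def erlangMeasure (m : ℕ) : Measure ℝ :=
  -- A zero exponent must have transform 1, which calls for a point mass: the Gamma law needs
  -- positive shape.
  if m = 0 then Measure.dirac 0 else gammaMeasure m 1

instance (m : ℕ) : IsProbabilityMeasure (erlangMeasure m) := by
  unfold erlangMeasure
  split_ifs with h
  · infer_instance
  · exact isProbabilityMeasure_gammaMeasure (by positivity) one_pos

theorem ae_nonneg_erlangMeasure (m : ℕ) : ∀ᵐ x ∂erlangMeasure m, 0 ≤ x := by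
  unfold erlangMeasure
  split_ifs with h
  · rw [ae_dirac_eq]
    exact le_refl (0 : ℝ)
  · exact ae_nonneg_gammaMeasure _ _

theorem lintegral_exp_neg_mul_erlangMeasure (m : ℕ) {t : ℝ} (ht : 0 ≤ t) :
    ∫⁻ x, ENNReal.ofReal (Real.exp (-(t * x))) ∂erlangMeasure m =
      ENNReal.ofReal (1 + t)⁻¹ ^ m := by
  unfold erlangMeasure
  split_ifs with h
  · simp [h]
  · rw [lintegral_exp_neg_mul_gammaMeasure (by positivity) ht, Real.rpow_natCast,
      ENNReal.ofReal_pow (by positivity)]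

theorem lintegral_exp_neg_sum_pi {n : ℕ} (μ : Fin n → Measure ℝ) [∀ i, IsProbabilityMeasure (μ i)]
    (t : Fin n → ℝ) :
    ∫⁻ y, ENNReal.ofReal (Real.exp (-∑ i, t i * y i)) ∂Measure.pi μ =
      ∏ i, ∫⁻ x, ENNReal.ofReal (Real.exp (-(t i * x))) ∂μ i := by
  have h : ∀ y : Fin n → ℝ, ENNReal.ofReal (Real.exp (-∑ i, t i * y i)) =
      ∏ i, ENNReal.ofReal (Real.exp (-(t i * y i))) := fun y => by
    rw [← Finset.sum_neg_distrib, Real.exp_sum,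
      ENNReal.ofReal_prod_of_nonneg fun i _ => (Real.exp_pos _).le]
  have hm : ∀ i, Measurable fun x : ℝ => ENNReal.ofReal (Real.exp (-(t i * x))) := fun i => by
    fun_prop
  rw [lintegral_congr h, lintegral_prod_eq_prod_lintegral_of_indepFun Finset.univ
    (fun i (y : Fin n → ℝ) => ENNReal.ofReal (Real.exp (-(t i * y i))))
    (iIndepFun_pi fun i => (hm i).aemeasurable) (fun i => by fun_prop)]
  refine Finset.prod_congr rfl fun i _ => ?_
  exact (measurePreserving_eval μ i).lintegral_comp (hm i)

theorem ae_nonneg_pi {n : ℕ} {μ : Fin n → Measure ℝ} [∀ i, IsProbabilityMeasure (μ i)]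
    (h : ∀ i, ∀ᵐ x ∂μ i, 0 ≤ x) : ∀ᵐ y ∂Measure.pi μ, ∀ i, 0 ≤ y i :=
  ae_all_iff.2 fun i => (measurePreserving_eval μ i).quasiMeasurePreserving.ae (h i)

/-- A power series with nonnegative coefficients summing to `1` is the probability generating
function of the shape parameters of a mixture of products of Erlang laws. -/
theorem IsNonnegPowerSeries.exists_erlang_mixture {n : ℕ} {g : (Fin n → ℝ) → ENNReal}
    (hg : IsNonnegPowerSeries g) (h1 : g (fun _ => 1) = 1) :
    ∃ ν : Measure (Fin n → ℝ), IsProbabilityMeasure ν ∧ (∀ᵐ y ∂ν, ∀ i, 0 ≤ y i) ∧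
      ∀ t : Fin n → ℝ, (∀ i, 0 ≤ t i) →
        ∫⁻ y, ENNReal.ofReal (Real.exp (-∑ i, t i * y i)) ∂ν = g fun i => (1 + t i)⁻¹ := by
  obtain ⟨ι, c, e, H⟩ := hg
  refine ⟨Measure.sum fun i => c i • Measure.pi fun j => erlangMeasure (e i j), ⟨?_⟩, ?_,
    fun t ht => ?_⟩
  -- The total mass is the sum of the coefficients, that is, g(1, …, 1).
  · have h := H _ fun _ => ⟨zero_le_one, le_rfl⟩
    rw [h1] at h
    simpa only [Measure.sum_apply _ MeasurableSet.univ, Measure.smul_apply, measure_univ,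
      smul_eq_mul, ENNReal.ofReal_one, one_pow, Finset.prod_const_one] using h.symm
  · refine (Measure.ae_sum_iff' ?_).2 fun i =>
      Measure.ae_smul_measure (ae_nonneg_pi fun j => ae_nonneg_erlangMeasure (e i j)) (c i)
    rw [Set.ofPred_forall]
    exact MeasurableSet.iInter fun i => measurableSet_le measurable_const (measurable_pi_apply i)
  · rw [lintegral_sum_measure, H _ fun i => ⟨inv_nonneg.2 (by linarith [ht i]),
      inv_le_one_of_one_le₀ (by linarith [ht i])⟩]
    refine tsum_congr fun i => ?_
    rw [lintegral_smul_measure, lintegral_exp_neg_sum_pi, smul_eq_mul]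
    exact congrArg _ (Finset.prod_congr rfl fun j _ =>
      lintegral_exp_neg_mul_erlangMeasure (e i j) (ht j))

/-! ### Uniqueness of Laplace transforms and nonnegativity. -/

section LaplaceUniqueness

open scoped BoundedContinuousFunction

variable {n : ℕ}

/-- The bounded continuous function `x ↦ exp (-∑ kᵢ xᵢ)` on the nonnegative orthant. -/
noncomputable def expNegSum (k : Fin n → ℕ) : (Fin n → NNReal) →ᵇ ℝ :=
  BoundedContinuousFunction.ofNormedAddCommGroup
    (fun x => Real.exp (-∑ i, (k i : ℝ) * (x i : ℝ))) (by fun_prop) 1 fun x => by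
      rw [Real.norm_eq_abs, Real.abs_exp, Real.exp_le_one_iff, neg_nonpos]
      positivity

theorem expNegSum_apply (k : Fin n → ℕ) (x : Fin n → NNReal) :
    expNegSum k x = Real.exp (-∑ i, (k i : ℝ) * (x i : ℝ)) := rfl

/-- Products only add exponents, so the algebra generated by these exponentials is just their linear
span. -/
theorem exists_eq_expNegSum_of_mem_closure {f : (Fin n → NNReal) →ᵇ ℝ}
    (hf : f ∈ Submonoid.closure (Set.range (expNegSum (n := n)))) : ∃ k, f = expNegSum k := by
  induction hf using Submonoid.closure_induction with
  | mem f hf => exact hf.imp fun k h => h.symm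
  | one =>
    refine ⟨0, ?_⟩
    ext x
    simp [expNegSum_apply]
  | mul f g _ _ hf hg =>
    obtain ⟨k, rfl⟩ := hf
    obtain ⟨l, rfl⟩ := hg
    refine ⟨k + l, ?_⟩
    ext x
    simp only [BoundedContinuousFunction.mul_apply, expNegSum_apply, ← Real.exp_add,
      Pi.add_apply, Nat.cast_add, add_mul, Finset.sum_add_distrib]
    congr 1
    ring

/-- The real algebra generated by the functions `x ↦ exp (-∑ kᵢ xᵢ)`. -/
noncomputable def expNegSumAlgebra (n : ℕ) : StarSubalgebra ℝ ((Fin n → NNReal) →ᵇ ℝ) where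
  toSubalgebra := Algebra.adjoin ℝ (Set.range expNegSum)
  star_mem' {f} hf := by
    have h : star f = f := by
      ext x
      simp
    rwa [h]

/-- Finite measures on the nonnegative orthant are determined by their Laplace transforms. -/
theorem ext_of_integral_expNegSum {μ ν : Measure (Fin n → NNReal)} [IsFiniteMeasure μ]
    [IsFiniteMeasure ν] (h : ∀ k, ∫ x, expNegSum k x ∂μ = ∫ x, expNegSum k x ∂ν) : μ = ν := by
  -- A point-separating algebra of bounded continuous functions determines a finite measure; integer
  -- exponents already separate points.
  refine ext_of_forall_mem_subalgebra_integral_eq_of_polish (𝕜 := ℝ)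
    (A := expNegSumAlgebra n) ?_ fun g hg => ?_
  · intro x y hxy
    obtain ⟨i, hi⟩ := Function.ne_iff.1 hxy
    refine ⟨_, ⟨_, ⟨expNegSum (Pi.single i 1), ?_, rfl⟩, rfl⟩, ?_⟩
    · exact Algebra.subset_adjoin ⟨_, rfl⟩
    · change expNegSum (Pi.single i 1) x ≠ expNegSum (Pi.single i 1) y
      simpa [expNegSum_apply, Pi.single_apply] using hi
  · have hg' : g ∈ Submodule.span ℝ
        (Submonoid.closure (Set.range (expNegSum (n := n))) : Set ((Fin n → NNReal) →ᵇ ℝ)) := by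
      rw [← Algebra.adjoin_eq_span]
      exact hg
    clear hg
    induction hg' using Submodule.span_induction with
    | mem f hf =>
      obtain ⟨k, rfl⟩ := exists_eq_expNegSum_of_mem_closure hf
      exact h k
    | zero => simp
    | add f g _ _ hf hg =>
      simp only [BoundedContinuousFunction.add_apply]
      rw [integral_add (f.integrable _) (g.integrable _),
        integral_add (f.integrable _) (g.integrable _), hf, hg]
    | smul a f _ hf =>
      simp only [BoundedContinuousFunction.smul_apply]
      rw [integral_smul, integral_smul, hf]

/-- The exponentials are bounded only on the orthant, so both measures are pushed there; truncation
is almost surely undone by coercion. -/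
theorem ext_of_integral_exp_neg_sum_of_ae_nonneg {μ ν : Measure (Fin n → ℝ)} [IsFiniteMeasure μ]
    [IsFiniteMeasure ν] (hμ : ∀ᵐ x ∂μ, ∀ i, 0 ≤ x i) (hν : ∀ᵐ x ∂ν, ∀ i, 0 ≤ x i)
    (h : ∀ s : Fin n → ℝ, (∀ i, 0 ≤ s i) →
      ∫ x, Real.exp (-∑ i, s i * x i) ∂μ = ∫ x, Real.exp (-∑ i, s i * x i) ∂ν) : μ = ν := by
  have hp : Measurable fun (x : Fin n → ℝ) i => (x i).toNNReal := by fun_prop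
  have hc : Measurable fun (y : Fin n → NNReal) i => (y i : ℝ) := by fun_prop
  have hmap : ∀ {ρ : Measure (Fin n → ℝ)}, (∀ᵐ x ∂ρ, ∀ i, 0 ≤ x i) →
      (ρ.map fun x i => (x i).toNNReal).map (fun y i => (y i : ℝ)) = ρ := fun {ρ} hρ => by
    rw [Measure.map_map hc hp]
    conv_rhs => rw [← Measure.map_id (μ := ρ)]
    refine Measure.map_congr (hρ.mono fun x hx => ?_)
    funext i
    simp [hx i]
  have hint : ∀ {ρ : Measure (Fin n → ℝ)}, (∀ᵐ x ∂ρ, ∀ i, 0 ≤ x i) → ∀ k : Fin n → ℕ,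
      ∫ y, expNegSum k y ∂(ρ.map fun x i => (x i).toNNReal) =
        ∫ x, Real.exp (-∑ i, (k i : ℝ) * x i) ∂ρ := fun {ρ} hρ k => by
    rw [integral_map hp.aemeasurable (expNegSum k).continuous.aestronglyMeasurable]
    refine integral_congr_ae (hρ.mono fun x hx => ?_)
    simp [expNegSum_apply, hx]
  rw [← hmap hμ, ← hmap hν, ext_of_integral_expNegSum (μ := μ.map fun x i => (x i).toNNReal)
    (ν := ν.map fun x i => (x i).toNNReal) fun k => ?_]
  rw [hint hμ, hint hν, h _ fun i => Nat.cast_nonneg _]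

/-- A real random variable whose Laplace transform is bounded on `[0, ∞)` is nonnegative. -/
theorem ae_nonneg_of_integral_exp_neg_mul_le {Ω : Type*} [MeasurableSpace Ω] {P : Measure Ω}
    {Y : Ω → ℝ} {C : ℝ} (hi : ∀ s : ℝ, 0 ≤ s → Integrable (fun ω => Real.exp (-(s * Y ω))) P)
    (hC : ∀ s : ℝ, 0 ≤ s → ∫ ω, Real.exp (-(s * Y ω)) ∂P ≤ C) : ∀ᵐ ω ∂P, 0 ≤ Y ω := by
  have hε : ∀ m : ℕ, ∀ᵐ ω ∂P, -(1 / ((m : ℝ) + 1)) < Y ω := fun m => by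
    set ε : ℝ := 1 / ((m : ℝ) + 1) with hεdef
    have hε0 : 0 < ε := by positivity
    -- Chernoff bound: exp(-sY) ≥ exp(sε) where Y ≤ -ε. Letting s → ∞ makes that event null.
    have hbound : ∀ s : ℝ, 0 ≤ s →
        P {ω | ¬ -ε < Y ω} ≤ ENNReal.ofReal (C * Real.exp (-(s * ε))) := fun s hs => by
      have h := mul_meas_ge_le_lintegral₀
        (hi s hs).aemeasurable.ennreal_ofReal (ENNReal.ofReal (Real.exp (s * ε)))
      rw [← ofReal_integral_eq_lintegral_ofReal (hi s hs)
        (Filter.Eventually.of_forall fun _ => (Real.exp_pos _).le)] at h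
      have h2 : P {ω | ¬ -ε < Y ω} ≤ P {ω | ENNReal.ofReal (Real.exp (s * ε)) ≤
          ENNReal.ofReal (Real.exp (-(s * Y ω)))} := measure_mono fun ω hω => by
        refine ENNReal.ofReal_le_ofReal (Real.exp_le_exp.2 ?_)
        have : Y ω ≤ -ε := not_lt.1 hω
        nlinarith
      calc P {ω | ¬ -ε < Y ω}
          = ENNReal.ofReal (Real.exp (-(s * ε))) * (ENNReal.ofReal (Real.exp (s * ε)) *
              P {ω | ¬ -ε < Y ω}) := by
            rw [← mul_assoc, ← ENNReal.ofReal_mul (Real.exp_pos _).le, ← Real.exp_add]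
            simp
        _ ≤ ENNReal.ofReal (Real.exp (-(s * ε))) * ENNReal.ofReal C := by
            gcongr
            exact ((mul_le_mul_right h2 _).trans h).trans (ENNReal.ofReal_le_ofReal (hC s hs))
        _ = ENNReal.ofReal (C * Real.exp (-(s * ε))) := by
            rw [← ENNReal.ofReal_mul (Real.exp_pos _).le, mul_comm]
    have hlim : Filter.Tendsto (fun s : ℝ => ENNReal.ofReal (C * Real.exp (-(s * ε))))
        Filter.atTop (nhds 0) := by
      have h1 : Filter.Tendsto (fun s : ℝ => C * Real.exp (-(s * ε))) Filter.atTop (nhds (C * 0)) :=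
        (Real.tendsto_exp_neg_atTop_nhds_zero.comp
          (Filter.tendsto_id.atTop_mul_const hε0)).const_mul C
      simpa using ENNReal.tendsto_ofReal h1
    exact le_antisymm (ge_of_tendsto hlim ((Filter.eventually_ge_atTop 0).mono hbound)) zero_le
  filter_upwards [ae_all_iff.2 hε] with ω hω
  have h := tendsto_one_div_add_atTop_nhds_zero_nat (𝕜 := ℝ)
  have h2 : Filter.Tendsto (fun m : ℕ => -(1 / ((m : ℝ) + 1))) Filter.atTop (nhds 0) := by
    simpa using h.neg
  exact le_of_tendsto h2 (Filter.Eventually.of_forall fun m => (hω m).le)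

end LaplaceUniqueness

/-! ### M-matrices and the Jacobi splitting. -/

/-- Telescoping gives partial sums R - R M^N, which are bounded entrywise by R. -/
theorem Matrix.summable_pow_of_inv_one_sub_nonneg {n : ℕ} {M R : Matrix (Fin n) (Fin n) ℝ}
    (hM : ∀ i j, 0 ≤ M i j) (hR : R * (1 - M) = 1) (hR0 : ∀ i j, 0 ≤ R i j) :
    Summable fun m : ℕ => M ^ m := by
  have hp : ∀ (m : ℕ) i j, 0 ≤ (M ^ m) i j := fun m i j =>
    (pow_le_pow_of_entrywise hM (fun _ _ => le_rfl) m i j).1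
  refine Pi.summable.2 fun i => Pi.summable.2 fun j =>
    summable_of_sum_range_le (c := R i j) (fun m => hp m i j) fun N => ?_
  have h : ∑ m ∈ Finset.range N, M ^ m = R - R * M ^ N := by
    rw [← one_mul (∑ m ∈ Finset.range N, M ^ m), ← hR, mul_assoc, mul_neg_geom_sum, mul_sub,
      mul_one]
  rw [← Matrix.sum_apply, h, Matrix.sub_apply, Matrix.mul_apply]
  exact sub_le_self _ (Finset.sum_nonneg fun k _ => mul_nonneg (hR0 i k) (hp N k j))

namespace IsNonsingularMMatrix

variable {n : ℕ} {A : Matrix (Fin n) (Fin n) ℝ}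

/-- In the (i, i) entry of A A⁻¹ = 1 the off-diagonal terms are nonpositive, so the diagonal term is
at least 1. -/
theorem diag_pos (hA : IsNonsingularMMatrix A) (i : Fin n) : 0 < A i i := by
  have h : (A * A⁻¹) i i = 1 := by
    rw [Matrix.mul_nonsing_inv _ ((Matrix.isUnit_iff_isUnit_det A).1 hA.nonsingular),
      Matrix.one_apply_eq]
  rw [Matrix.mul_apply, ← Finset.add_sum_erase _ _ (Finset.mem_univ i)] at h
  have h2 : ∑ k ∈ Finset.univ.erase i, A i k * A⁻¹ k i ≤ 0 := Finset.sum_nonpos fun k hk =>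
    mul_nonpos_of_nonpos_of_nonneg (hA.offDiag_nonpos i k (Finset.ne_of_mem_erase hk).symm)
      (hA.inv_nonneg k i)
  exact pos_of_mul_pos_left (by linarith) (hA.inv_nonneg i i)

end IsNonsingularMMatrix

namespace Matrix

variable {n : ℕ}

/-- The iteration matrix `1 - D⁻¹ A` of the Jacobi method, `D` being the diagonal part of `A`. -/
noncomputable def jacobi (A : Matrix (Fin n) (Fin n) ℝ) : Matrix (Fin n) (Fin n) ℝ :=
  1 - Matrix.diagonal (fun i => (A i i)⁻¹) * A

variable {A : Matrix (Fin n) (Fin n) ℝ}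

theorem jacobi_nonneg (hA : IsNonsingularMMatrix A) (i j : Fin n) : 0 ≤ jacobi A i j := by
  rw [jacobi, sub_apply, diagonal_mul]
  by_cases h : i = j
  · subst h
    simp [(hA.diag_pos i).ne']
  · rw [one_apply_ne h, zero_sub, neg_nonneg]
    exact mul_nonpos_of_nonneg_of_nonpos (inv_nonneg.2 (hA.diag_pos i).le)
      (hA.offDiag_nonpos i j h)

theorem summable_jacobi_pow (hA : IsNonsingularMMatrix A) :
    Summable fun m : ℕ => jacobi A ^ m := by
  -- 1 - M = D⁻¹A has the nonnegative inverse A⁻¹D.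
  refine summable_pow_of_inv_one_sub_nonneg (R := A⁻¹ * diagonal fun i => A i i)
    (jacobi_nonneg hA) ?_ fun i j => ?_
  · rw [jacobi, sub_sub_cancel, mul_assoc, ← mul_assoc (diagonal _), diagonal_mul_diagonal]
    simp only [mul_inv_cancel₀ (hA.diag_pos _).ne', diagonal_one, one_mul]
    exact nonsing_inv_mul _ ((isUnit_iff_isUnit_det A).1 hA.nonsingular)
  · rw [mul_diagonal]
    exact mul_nonneg (hA.inv_nonneg i j) (hA.diag_pos j).le

theorem det_one_sub_jacobi_pos (hA : IsNonsingularMMatrix A) : 0 < (1 - jacobi A).det :=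
  det_one_sub_pos_of_summable (jacobi_nonneg hA) (summable_jacobi_pow hA)

/-- Both sides are determinants of D⁻¹(A + S), factored as D⁻¹A(1 + A⁻¹S) and as diag(x)⁻¹(1 -
diag(x) M). -/
theorem det_one_add_inv_mul_diagonal (hA : IsNonsingularMMatrix A) {s : Fin n → ℝ}
    (hs : ∀ i, 0 ≤ s i) :
    (1 + A⁻¹ * diagonal s).det * (1 - jacobi A).det =
      (∏ i, (1 + s i * (A i i)⁻¹)) *
        (1 - diagonal (fun i => (1 + s i * (A i i)⁻¹)⁻¹) * jacobi A).det := by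
  have hpos : ∀ i, 0 < 1 + s i * (A i i)⁻¹ := fun i => by
    have := hA.diag_pos i
    have := hs i
    positivity
  rw [mul_comm (det _), ← det_diagonal, ← det_mul, ← det_mul, jacobi, sub_sub_cancel, mul_add, mul_one,
    mul_assoc, ← mul_assoc A, mul_nonsing_inv _ ((isUnit_iff_isUnit_det A).1 hA.nonsingular),
    one_mul, diagonal_mul_diagonal, mul_sub, mul_one, ← mul_assoc, diagonal_mul_diagonal]
  simp only [mul_inv_cancel₀ (hpos _).ne', diagonal_one, one_mul]
  congr 1
  ext i j
  rw [add_apply, sub_apply, sub_apply]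
  by_cases h : i = j
  · subst h
    simp only [diagonal_apply_eq, one_apply_eq]
    ring
  · simp [h]

end Matrix

/-! ### The decomposition and the coupling. -/

/-- The mixing law of the Erlang components in the decomposition of a permanental vector. -/
theorem exists_erlang_mixture_of_isNonsingularMMatrix {n : ℕ} {A : Matrix (Fin n) (Fin n) ℝ}
    (hA : IsNonsingularMMatrix A) {α : ℝ} (hα : 0 < α) :
    ∃ ν : Measure (Fin n → ℝ), IsProbabilityMeasure ν ∧ (∀ᵐ y ∂ν, ∀ i, 0 ≤ y i) ∧
      ∀ s : Fin n → ℝ, (∀ i, 0 ≤ s i) →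
        (∏ i, ENNReal.ofReal ((1 + s i * (A i i)⁻¹)⁻¹ ^ α)) *
          ∫⁻ y, ENNReal.ofReal (Real.exp (-∑ i, s i * (A i i)⁻¹ * y i)) ∂ν =
        ENNReal.ofReal (1 / (1 + A⁻¹ * Matrix.diagonal s).det ^ α) := by
  have hM := Matrix.jacobi_nonneg hA
  have hs := Matrix.summable_jacobi_pow hA
  have hd := Matrix.det_one_sub_jacobi_pos hA
  -- The constant |1 - M|^α normalizes the series to 1 at x = (1, …, 1).
  obtain ⟨ν, hν, hν0, hL⟩ := ((IsNonnegPowerSeries.const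
    (ENNReal.ofReal ((1 - Matrix.jacobi A).det ^ α))).mul
    (isNonnegPowerSeries_det_one_sub_rpow_neg hM hs hα)).exists_erlang_mixture (by
      rw [Matrix.diagonal_one, one_mul, ← ENNReal.ofReal_mul (by positivity),
        ← Real.rpow_add hd, add_neg_cancel, Real.rpow_zero, ENNReal.ofReal_one])
  refine ⟨ν, hν, hν0, fun s h0 => ?_⟩
  have ht : ∀ i, 0 ≤ s i * (A i i)⁻¹ := fun i => mul_nonneg (h0 i) (inv_nonneg.2 (hA.diag_pos i).le)
  have hx : ∀ i, (1 + s i * (A i i)⁻¹)⁻¹ ∈ Set.Icc (0 : ℝ) 1 := fun i =>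
    ⟨inv_nonneg.2 (by linarith [ht i]), inv_le_one_of_one_le₀ (by linarith [ht i])⟩
  have hdx := Matrix.det_one_sub_pos_of_summable (diagonal_mul_nonneg hM hx)
    (summable_diagonal_mul_pow hM hs hx)
  have hprod : 0 < ∏ i, (1 + s i * (A i i)⁻¹) := Finset.prod_pos fun i _ => by linarith [ht i]
  have hdet : (1 + A⁻¹ * Matrix.diagonal s).det = (∏ i, (1 + s i * (A i i)⁻¹)) *
      (1 - Matrix.diagonal (fun i => (1 + s i * (A i i)⁻¹)⁻¹) * Matrix.jacobi A).det *
        (1 - Matrix.jacobi A).det⁻¹ := by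
    rw [← Matrix.det_one_add_inv_mul_diagonal hA h0, mul_inv_cancel_right₀ hd.ne']
  have hxα : ∀ i, 0 ≤ (1 + s i * (A i i)⁻¹)⁻¹ ^ α := fun i => Real.rpow_nonneg (hx i).1 _
  rw [hL _ ht, hdet, ← ENNReal.ofReal_prod_of_nonneg fun i _ => hxα i,
    ← ENNReal.ofReal_mul (by positivity),
    ← ENNReal.ofReal_mul (Finset.prod_nonneg fun i _ => hxα i),
    Real.finsetProd_rpow _ _ fun i _ => (hx i).1, Finset.prod_inv_distrib,
    Real.mul_rpow (by positivity) (by positivity), Real.mul_rpow hprod.le hdx.le,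
    Real.inv_rpow hprod.le, Real.inv_rpow hd.le, Real.rpow_neg hdx.le]
  congr 1
  field_simp

theorem integral_exp_neg_sum_gamma_add {n : ℕ} {α : ℝ} (hα : 0 < α) (ν : Measure (Fin n → ℝ))
    [IsProbabilityMeasure ν] {b s : Fin n → ℝ} (hb : ∀ i, 0 ≤ b i) (hs : ∀ i, 0 ≤ s i) :
    ∫ p, Real.exp (-∑ i, s i * (b i * (p.1 i + p.2 i)))
        ∂(Measure.pi fun _ : Fin n => gammaMeasure α 1).prod ν =
      ((∏ i, ENNReal.ofReal ((1 + s i * b i)⁻¹ ^ α)) *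
        ∫⁻ y, ENNReal.ofReal (Real.exp (-∑ i, s i * b i * y i)) ∂ν).toReal := by
  have hγ := isProbabilityMeasure_gammaMeasure hα one_pos
  have hsplit : ∀ p : (Fin n → ℝ) × (Fin n → ℝ),
      ENNReal.ofReal (Real.exp (-∑ i, s i * (b i * (p.1 i + p.2 i)))) =
        ENNReal.ofReal (Real.exp (-∑ i, s i * b i * p.1 i)) *
          ENNReal.ofReal (Real.exp (-∑ i, s i * b i * p.2 i)) := fun p => by
    rw [← ENNReal.ofReal_mul (Real.exp_pos _).le, ← Real.exp_add, ← neg_add,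
      ← Finset.sum_add_distrib]
    simp only [mul_add, mul_assoc]
  have hm : Measurable fun x : Fin n → ℝ => ENNReal.ofReal (Real.exp (-∑ i, s i * b i * x i)) := by
    fun_prop
  rw [integral_eq_lintegral_of_nonneg_ae (Filter.Eventually.of_forall fun _ =>
      (Real.exp_pos _).le) (Measurable.aestronglyMeasurable (by fun_prop)),
    lintegral_congr hsplit, lintegral_prod_mul hm.aemeasurable hm.aemeasurable,
    lintegral_exp_neg_sum_pi]
  simp only [fun i => lintegral_exp_neg_mul_gammaMeasure hα (mul_nonneg (hs i) (hb i))]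

/-- The coupling is a pair `(X', ξ)` on one probability space, where `X'` has the law of `X`
and `ξ` consists of independent Gamma variables of shape `α` and rate `1`. -/
theorem theorem1p1 {Ω : Type*} [MeasurableSpace Ω] (P : Measure Ω) [IsProbabilityMeasure P]
    (n : ℕ) (α : ℝ) (hα : 0 < α) (K : Matrix (Fin n) (Fin n) ℝ) (hK : IsUnit K)
    (hA : IsNonsingularMMatrix K⁻¹)
    (X : Ω → Fin n → ℝ) (hX : IsPermanentalVector P α K X) :
    ∃ (Ω' : Type) (_ : MeasurableSpace Ω') (P' : Measure Ω') (_ : IsProbabilityMeasure P')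
      (X' : Ω' → Fin n → ℝ) (ξ : Fin n → Ω' → ℝ),
      IdentDistrib X' X P' P ∧
      iIndepFun ξ P' ∧
      (∀ i, HasLaw (ξ i) (gammaMeasure α 1) P') ∧
      ∀ᵐ ω ∂P', ∀ i, (K⁻¹ i i)⁻¹ * ξ i ω ≤ X' ω i := by
  obtain ⟨ν, hν, hν0, hL⟩ := exists_erlang_mixture_of_isNonsingularMMatrix hA hα
  rw [Matrix.nonsing_inv_nonsing_inv K ((Matrix.isUnit_iff_isUnit_det K).1 hK)] at hL
  have hγ := isProbabilityMeasure_gammaMeasure hα one_pos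
  have ha : ∀ i, 0 ≤ (K⁻¹ i i)⁻¹ := fun i => inv_nonneg.2 (hA.diag_pos i).le
  -- The product measure makes ξ (first component) independent of η (second component, of law ν).
  set Q : Measure ((Fin n → ℝ) × (Fin n → ℝ)) :=
    (Measure.pi fun _ => gammaMeasure α 1).prod ν with hQ
  set X' : (Fin n → ℝ) × (Fin n → ℝ) → Fin n → ℝ :=
    fun p i => (K⁻¹ i i)⁻¹ * (p.1 i + p.2 i) with hX'
  have hX'm : Measurable X' := by fun_prop
  have hfst : MeasurePreserving Prod.fst Q (Measure.pi fun _ => gammaMeasure α 1) :=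
    measurePreserving_fst
  have hη0 : ∀ᵐ p ∂Q, ∀ i, 0 ≤ p.2 i := measurePreserving_snd.quasiMeasurePreserving.ae hν0
  have hξ0 : ∀ᵐ p ∂Q, ∀ i, 0 ≤ p.1 i :=
    hfst.quasiMeasurePreserving.ae (ae_nonneg_pi fun _ => ae_nonneg_gammaMeasure _ _)
  have hlaw : ∀ i, HasLaw (fun p : (Fin n → ℝ) × (Fin n → ℝ) => p.1 i) (gammaMeasure α 1) Q :=
    fun i => ⟨by fun_prop, ((measurePreserving_eval _ i).comp hfst).map_eq⟩
  have hlap : ∀ s : Fin n → ℝ, (∀ i, 0 ≤ s i) →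
      ∫ p, Real.exp (-∑ i, s i * X' p i) ∂Q = ∫ ω, Real.exp (-∑ i, s i * X ω i) ∂P := by
    intro s hs
    rw [integral_exp_neg_sum_gamma_add hα ν ha hs, hL s hs, ← hX.laplace s hs,
      ENNReal.toReal_ofReal (integral_nonneg fun _ => (Real.exp_pos _).le)]
  have hX'0 : ∀ᵐ p ∂Q, ∀ i, 0 ≤ X' p i := by
    filter_upwards [hη0, hξ0] with p h2 h1 i
    exact mul_nonneg (ha i) (add_nonneg (h1 i) (h2 i))
  -- Nonnegativity of X is not part of the definition. Along each coordinate axis its transform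
  -- equals that of X' ≥ 0, hence is at most 1.
  have hX0 : ∀ᵐ ω ∂P, ∀ i, 0 ≤ X ω i := by
    refine ae_all_iff.2 fun i => ?_
    have hsum : ∀ (s : ℝ) (y : Fin n → ℝ), ∑ j, (Pi.single i s : Fin n → ℝ) j * y j = s * y i :=
      fun s y => by simp [Pi.single_apply]
    have hs0 : ∀ s : ℝ, 0 ≤ s → ∀ j, 0 ≤ (Pi.single i s : Fin n → ℝ) j := fun s hs j => by
      rw [Pi.single_apply]
      split_ifs
      exacts [hs, le_rfl]
    refine ae_nonneg_of_integral_exp_neg_mul_le (C := 1) (fun s hs => ?_) fun s hs => ?_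
    · simpa only [hsum] using hX.integrable _ (hs0 s hs)
    · have h := hlap _ (hs0 s hs)
      simp only [hsum] at h
      rw [← h]
      refine (integral_mono_of_nonneg (Filter.Eventually.of_forall fun _ => (Real.exp_pos _).le)
        (integrable_const (1 : ℝ)) (hX'0.mono fun p hp => ?_)).trans (by simp)
      exact Real.exp_le_one_iff.2 (neg_nonpos.2 (mul_nonneg hs (hp i)))
  refine ⟨_, _, Q, inferInstance, X', fun i p => p.1 i, ⟨hX'm.aemeasurable, hX.aemeasurable, ?_⟩,
    ?_, hlaw, ?_⟩
  · have := Measure.isProbabilityMeasure_map hX'm.aemeasurable (μ := Q)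
    have := Measure.isProbabilityMeasure_map hX.aemeasurable
    have hms : MeasurableSet {x : Fin n → ℝ | ∀ i, 0 ≤ x i} := by
      rw [Set.ofPred_forall]
      exact MeasurableSet.iInter fun i => measurableSet_le measurable_const (measurable_pi_apply i)
    refine ext_of_integral_exp_neg_sum_of_ae_nonneg ((ae_map_iff hX'm.aemeasurable hms).2 hX'0)
      ((ae_map_iff hX.aemeasurable hms).2 hX0) fun s hs => ?_
    rw [integral_map hX'm.aemeasurable (Measurable.aestronglyMeasurable (by fun_prop)),
      integral_map hX.aemeasurable (Measurable.aestronglyMeasurable (by fun_prop)), hlap s hs]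
  · rw [iIndepFun_iff_map_fun_eq_pi_map fun i => (hlaw i).aemeasurable]
    simp only [fun i => (hlaw i).map_eq]
    exact hfst.map_eq
  · filter_upwards [hη0] with p hp i
    exact mul_le_mul_of_nonneg_left (le_add_of_nonneg_right (hp i)) (ha i)
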